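/- Throughout, $\|A\|$ is the operator (spectral) norm, $n\ge 1$, and all matrices are real $n\times n$. Consider, for a psd (symmetric positive semidefinite) matrix $A$, the renormalized MaxQP SDP: maximize $\operatorname{tr}\big(\tfrac1{\|A\|}AX\big)$ over all psd matrices $X$ with $\operatorname{tr}X=1$ and $X_{ii}=\tfrac1n$ for all $i$ (if $A=0$ the objective is read as $0$). A psd matrix $\rho$ with $\operatorname{tr}\rho=1$ is called an approximately feasible, optimal point with accuracy $\delta\ge 0$ if $\sum_{i}|\rho_{ii}-\tfrac1n|\le\delta$ and $\operatorname{tr}\big(\tfrac1{\|A\|}A\rho\big)\ge\operatorname{tr}\big(\tfrac1{\|A\|}AX\big)-\delta$ for every feasible $X$ of the SDP. (In particular every maximizer of the objective over all approximately feasible points is of this kind.) There is an absolute constant $C>0$ such that the following holds for all $n$, all psd $A$, all $\epsilon>0$ and every approximately feasible, optimal point $\rho^\sharp$ with accuracy $\epsilon^4$. Let $v_1,\dots,v_n$ be the columns of the psd square root $\sqrt{\rho^\sharp}$, let $g\in\mathbb R^n$ have i.i.d. standard Gaussian entries, and put $x_i=\operatorname{sign}(\langle v_i,g\rangle)$, where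 $\operatorname{sign}(0)$ is any fixed number in $[-1,1]$ (for instance $1$, so that $x\in\{\pm1\}^n$). Then $$\frac2\pi\, n\operatorname{tr}(\rho^\sharp A)-C\,\epsilon\, n\|A\|\;\le\;\sum_{i,j}A_{ij}\,\mathbb E[x_ix_j]\;\le\; n\operatorname{tr}(\rho^\sharp A)+C\,\epsilon\, n\|A\|.$$ -/

import Mathlib

open MeasureTheory ProbabilityTheory
open scoped MatrixOrder

noncomputable section

/-- The operator (spectral) norm of a real square matrix, i.e. its norm as an operator on
Euclidean space. -/
def opNorm {n : ℕ} (A : Matrix (Fin n) (Fin n) ℝ) : ℝ :=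
  ‖Matrix.toEuclideanCLM (𝕜 := ℝ) A‖

/-- Objective of the renormalized MaxQP SDP: `tr ((1 / ‖A‖) A X)`. -/
def objective {n : ℕ} (A X : Matrix (Fin n) (Fin n) ℝ) : ℝ :=
  (((opNorm A)⁻¹ • A) * X).trace

/-- Quantum states: psd matrices of unit trace. -/
def IsState {n : ℕ} (X : Matrix (Fin n) (Fin n) ℝ) : Prop :=
  X.PosSemidef ∧ X.trace = 1

/-- Feasible points of the renormalized MaxQP SDP: states all of whose diagonal entries
equal `1 / n`. -/
def IsFeasible {n : ℕ} (X : Matrix (Fin n) (Fin n) ℝ) : Prop :=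
  IsState X ∧ ∀ i, X i i = 1 / (n : ℝ)

/-- Approximately feasible points with accuracy `δ`: states whose diagonal is `δ`-close to the
uniform distribution in `ℓ₁`. -/
def IsApproxFeasible {n : ℕ} (δ : ℝ) (X : Matrix (Fin n) (Fin n) ℝ) : Prop :=
  IsState X ∧ ∑ i, |X i i - 1 / (n : ℝ)| ≤ δ

/-- Approximately feasible, (approximately) optimal points with accuracy `δ` of the renormalized
MaxQP SDP with input matrix `A`: approximately feasible points whose objective value is, up to `δ`,
at least the optimal value of the SDP. (For `δ ≥ 0` this contains in particular all points that
are exactly or `δ`-approximately optimal among the approximately feasible ones.) -/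
def IsApproxSolution {n : ℕ} (A : Matrix (Fin n) (Fin n) ℝ) (δ : ℝ)
    (ρ : Matrix (Fin n) (Fin n) ℝ) : Prop :=
  IsApproxFeasible δ ρ ∧ ∀ X, IsFeasible X → objective A X ≤ objective A ρ + δ

/-- The sign function, with the value `s₀` at `0`. -/
def signWith (s₀ t : ℝ) : ℝ :=
  if 0 < t then 1 else if t < 0 then -1 else s₀

/-- The law of a vector with `n` i.i.d. standard Gaussian entries. -/
def stdGaussianVec (n : ℕ) : Measure (Fin n → ℝ) :=
  Measure.pi fun _ => gaussianReal 0 1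

/-- Gaussian rounding of `ρ`: the vector with entries `x i = sign ⟨v i, g⟩`, where `v i` is the
`i`-th column of the psd square root of `ρ`. -/
def gaussianRounding {n : ℕ} (s₀ : ℝ) (ρ : Matrix (Fin n) (Fin n) ℝ) (g : Fin n → ℝ)
    (i : Fin n) : ℝ :=
  signWith s₀ ((CFC.sqrt ρ).col i ⬝ᵥ g)

end

section GaussianIntegrals

/-! ### Gaussian integrals -/

/-! Lower bound: let `w i` be `v i` normalized and `c = √(2/π)`. The Gaussian identity `E[sign⟨v,g⟩
⟨w,g⟩] = c ⟨v/|v|, w⟩` (`integral_signWith_mul`) shows that the residuals `sign⟨v i,g⟩ - c⟨w i,g⟩`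
have second moments `E[x i x j] - (2/π)⟨w i, w j⟩`. That matrix is psd, so pairing it with `A` is
nonnegative. It remains to compare the Gram matrix of the `w i` with `n ρ`: the `ℓ₁` bound on the
diagonal makes the total squared distance from `√n v i` to `w i` at most `n ε⁴`, and a weighted
triangle inequality in the `A`-seminorm turns this into a loss of `2 ε² n ‖A‖`.

Upper bound: the second moment matrix of the signs, rescaled, is essentially a feasible point, so
near-optimality of `ρ` bounds its value. Large `ε` is trivial. -/

instance isProbabilityMeasure_stdGaussianVec (n : ℕ) : IsProbabilityMeasure (stdGaussianVec n) := by
  unfold stdGaussianVec; infer_instance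

theorem map_dotProduct_stdGaussianVec {n : ℕ} (v : Fin n → ℝ) :
    (stdGaussianVec n).map (fun g => v ⬝ᵥ g) = gaussianReal 0 (v ⬝ᵥ v).toNNReal := by
  set L : StrongDual ℝ (EuclideanSpace ℝ (Fin n)) := innerSL ℝ (WithLp.toLp 2 v) with hL
  have h1 : (fun g : Fin n → ℝ => v ⬝ᵥ g) = L ∘ (WithLp.toLp 2) := by
    ext g
    simp [hL, EuclideanSpace.inner_eq_star_dotProduct, dotProduct_comm]
  have h2 : ‖L‖ ^ 2 = v ⬝ᵥ v := by
    rw [hL, innerSL_apply_norm, EuclideanSpace.norm_sq_eq]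
    simp [dotProduct, sq]
  rw [h1, stdGaussianVec, ← Measure.map_map (by fun_prop) (by fun_prop), map_pi_eq_stdGaussian,
    IsGaussian.map_eq_gaussianReal, integral_strongDual_stdGaussian, variance_dual_stdGaussian, h2]

theorem gaussianReal_zero_eq_map (s : ℝ) :
    gaussianReal 0 (s ^ 2).toNNReal = (gaussianReal 0 1).map (s * ·) := by
  rw [gaussianReal_map_const_mul]
  congr 1
  · simp
  · ext; simp [sq_nonneg]

theorem integral_abs_gaussianReal : ∫ x, |x| ∂(gaussianReal 0 1) = √(2 / Real.pi) := by
  rw [integral_gaussianReal_eq_integral_smul one_ne_zero]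
  have h := integral_comp_abs (f := fun x : ℝ => (√(2 * Real.pi))⁻¹ * (x * Real.exp (-(1 / 2) * x ^ 2)))
  have h1 := integral_rpow_mul_exp_neg_mul_rpow (p := 2) (q := 1) (b := 1 / 2)
    (by norm_num) (by norm_num) (by norm_num)
  have h2 : ∫ x in Set.Ioi (0 : ℝ), x * Real.exp (-(1 / 2) * x ^ 2) = 1 := by
    refine Eq.trans ?_ (h1.trans ?_)
    · refine integral_congr_ae (Filter.Eventually.of_forall fun x => ?_)
      simp
    · norm_num [Real.rpow_neg]
  have h3 : (fun x : ℝ => gaussianPDFReal 0 1 x • |x|) =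
      fun x => (√(2 * Real.pi))⁻¹ * (|x| * Real.exp (-(1 / 2) * |x| ^ 2)) := by
    ext x
    simp only [gaussianPDFReal, NNReal.coe_one, mul_one, sub_zero, smul_eq_mul, sq_abs]
    rw [show -x ^ 2 / 2 = -(1 / 2) * x ^ 2 by ring]
    ring
  rw [h3, h, integral_const_mul, h2, Real.sqrt_div (by norm_num), Real.sqrt_mul (by norm_num)]
  have : √Real.pi ≠ 0 := by positivity
  have h4 : √(2 : ℝ) * √2 = 2 := Real.mul_self_sqrt (by norm_num)
  field_simp
  linarith

variable {n : ℕ}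

theorem measurable_dotProduct_right (v : Fin n → ℝ) : Measurable (fun g : Fin n → ℝ => v ⬝ᵥ g) := by
  simp only [dotProduct]; fun_prop

theorem memLp_dotProduct (v : Fin n → ℝ) : MemLp (fun g => v ⬝ᵥ g) 2 (stdGaussianVec n) := by
  have h := memLp_id_gaussianReal (μ := 0) (v := (v ⬝ᵥ v).toNNReal) 2
  rw [← map_dotProduct_stdGaussianVec] at h
  exact h.comp_of_map (measurable_dotProduct_right v).aemeasurable

theorem integral_abs_dotProduct (v : Fin n → ℝ) :
    ∫ g, |v ⬝ᵥ g| ∂(stdGaussianVec n) = √(2 / Real.pi) * √(v ⬝ᵥ v) := by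
  have hv : 0 ≤ v ⬝ᵥ v := by simpa using dotProduct_star_self_nonneg v
  have h := integral_map (μ := stdGaussianVec n) (measurable_dotProduct_right v).aemeasurable
    (f := fun x : ℝ => |x|) (by fun_prop)
  rw [← h, map_dotProduct_stdGaussianVec, ← Real.sq_sqrt hv, gaussianReal_zero_eq_map,
    integral_map (by fun_prop) (by fun_prop)]
  simp only [abs_mul, abs_of_nonneg (Real.sqrt_nonneg _), integral_const_mul,
    integral_abs_gaussianReal, Real.sqrt_sq (Real.sqrt_nonneg _)]
  ring

theorem integral_dotProduct_sq (v : Fin n → ℝ) :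
    ∫ g, (v ⬝ᵥ g) ^ 2 ∂(stdGaussianVec n) = v ⬝ᵥ v := by
  have hv : 0 ≤ v ⬝ᵥ v := by simpa using dotProduct_star_self_nonneg v
  have h := integral_map (μ := stdGaussianVec n) (measurable_dotProduct_right v).aemeasurable
    (f := fun x : ℝ => x ^ 2) (by fun_prop)
  have h1 := variance_eq_integral (μ := gaussianReal 0 (v ⬝ᵥ v).toNNReal) (X := id) (by fun_prop)
  rw [← h, map_dotProduct_stdGaussianVec]
  simp only [variance_id_gaussianReal, id, integral_id_gaussianReal, sub_zero] at h1
  rw [← h1, Real.coe_toNNReal _ hv]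

theorem integral_dotProduct_mul (v w : Fin n → ℝ) :
    ∫ g, (v ⬝ᵥ g) * (w ⬝ᵥ g) ∂(stdGaussianVec n) = v ⬝ᵥ w := by
  have h : ∀ g : Fin n → ℝ, (v ⬝ᵥ g) * (w ⬝ᵥ g) =
      2⁻¹ * (((v + w) ⬝ᵥ g) ^ 2 - (v ⬝ᵥ g) ^ 2 - (w ⬝ᵥ g) ^ 2) := fun g => by
    rw [add_dotProduct]; ring
  have hi := fun u : Fin n → ℝ => (memLp_dotProduct u).integrable_sq
  simp_rw [h]
  rw [integral_const_mul, integral_sub (by exact (hi _).sub (hi _)) (hi w),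
    integral_sub (hi _) (hi v)]
  simp only [integral_dotProduct_sq]
  simp only [add_dotProduct, dotProduct_add, dotProduct_comm w v]
  ring

theorem abs_signWith_le {s t : ℝ} (hs : |s| ≤ 1) : |signWith s t| ≤ 1 := by
  unfold signWith; split_ifs <;> simp [hs]

theorem measurable_signWith (s : ℝ) : Measurable (signWith s) := by
  unfold signWith
  exact Measurable.ite measurableSet_Ioi measurable_const
    (Measurable.ite measurableSet_Iio measurable_const measurable_const)

theorem signWith_mul_self (s t : ℝ) : signWith s t * t = |t| := by
  unfold signWith
  split_ifs with h1 h2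
  · simp [abs_of_pos h1]
  · simp [abs_of_neg h2]
  · simp [le_antisymm (not_lt.1 h1) (not_lt.1 h2)]

theorem integrable_signWith_mul {s : ℝ} (hs : |s| ≤ 1) (v w : Fin n → ℝ) :
    Integrable (fun g => signWith s (v ⬝ᵥ g) * (w ⬝ᵥ g)) (stdGaussianVec n) :=
  ((memLp_dotProduct w).integrable (by norm_num)).bdd_mul (c := 1)
    ((measurable_signWith s).comp (measurable_dotProduct_right v)).aestronglyMeasurable
    (Filter.Eventually.of_forall fun _ => abs_signWith_le hs)

theorem signWith_integral_le {s : ℝ} (hs : |s| ≤ 1) (v w : Fin n → ℝ) :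
    ∫ g, signWith s (v ⬝ᵥ g) * (w ⬝ᵥ g) ∂(stdGaussianVec n) ≤ √(2 / Real.pi) * √(w ⬝ᵥ w) := by
  rw [← integral_abs_dotProduct]
  refine integral_mono (integrable_signWith_mul hs v w)
    ((memLp_dotProduct w).integrable (by norm_num)).abs fun g => ?_
  refine (le_abs_self _).trans ?_
  rw [abs_mul]
  exact mul_le_of_le_one_left (abs_nonneg _) (abs_signWith_le hs)

/-- A tangent-line argument avoids any bivariate Gaussian computation. The function `t ↦ E|⟨v + t w,
g⟩| = c |v + t w|` dominates the affine function `t ↦ E[sign⟨v,g⟩ ⟨v + t w, g⟩]`, with equality at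
`t = 0`, so the derivatives there agree. -/
theorem integral_signWith_mul {s : ℝ} (hs : |s| ≤ 1) (v w : Fin n → ℝ) :
    ∫ g, signWith s (v ⬝ᵥ g) * (w ⬝ᵥ g) ∂(stdGaussianVec n) =
      √(2 / Real.pi) * ((√(v ⬝ᵥ v))⁻¹ * (v ⬝ᵥ w)) := by
  have hv : 0 ≤ v ⬝ᵥ v := by simpa using dotProduct_star_self_nonneg v
  rcases hv.eq_or_lt with h0 | hpos
  -- Here the sign is the constant `s` and `⟨w,g⟩` has mean zero; the right side vanishes too.
  · obtain rfl : v = 0 := dotProduct_self_eq_zero.1 h0.symm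
    simp only [zero_dotProduct, mul_zero]
    rw [integral_const_mul]
    have : ∫ g, w ⬝ᵥ g ∂(stdGaussianVec n) = 0 := by
      have h := integral_map (μ := stdGaussianVec n) (measurable_dotProduct_right w).aemeasurable
        (f := fun x : ℝ => x) (by fun_prop)
      rw [← h, map_dotProduct_stdGaussianVec, integral_id_gaussianReal]
    rw [this, mul_zero]
  set c := √(2 / Real.pi)
  set F := ∫ g, signWith s (v ⬝ᵥ g) * (w ⬝ᵥ g) ∂(stdGaussianVec n) with hF
  have key : ∀ t : ℝ, c * √(v ⬝ᵥ v) + t * F ≤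
      c * √(v ⬝ᵥ v + 2 * (v ⬝ᵥ w) * t + (w ⬝ᵥ w) * t ^ 2) := fun t => by
    have h := signWith_integral_le hs v (v + t • w)
    have h1 : ∀ g : Fin n → ℝ, signWith s (v ⬝ᵥ g) * ((v + t • w) ⬝ᵥ g) =
        |v ⬝ᵥ g| + t * (signWith s (v ⬝ᵥ g) * (w ⬝ᵥ g)) := fun g => by
      rw [← signWith_mul_self s, add_dotProduct, smul_dotProduct, smul_eq_mul]; ring
    simp_rw [h1] at h
    rw [integral_add ((memLp_dotProduct v).integrable (by norm_num)).abs
      ((integrable_signWith_mul hs v w).const_mul t), integral_const_mul,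
      integral_abs_dotProduct, ← hF] at h
    refine h.trans_eq ?_
    congr 2
    simp only [add_dotProduct, dotProduct_add, smul_dotProduct, dotProduct_smul, smul_eq_mul,
      dotProduct_comm w v]
    ring
  have hd : HasDerivAt (fun t : ℝ => c * √(v ⬝ᵥ v + 2 * (v ⬝ᵥ w) * t + (w ⬝ᵥ w) * t ^ 2) -
      (c * √(v ⬝ᵥ v) + t * F)) (c * ((2 * (v ⬝ᵥ w)) / (2 * √(v ⬝ᵥ v))) - F) 0 := by
    have hp : HasDerivAt (fun t : ℝ => v ⬝ᵥ v + 2 * (v ⬝ᵥ w) * t + (w ⬝ᵥ w) * t ^ 2)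
        (2 * (v ⬝ᵥ w)) 0 := by
      have := (((hasDerivAt_id (0 : ℝ)).const_mul (2 * (v ⬝ᵥ w))).const_add (v ⬝ᵥ v)).add
        ((hasDerivAt_pow 2 (0 : ℝ)).const_mul (w ⬝ᵥ w))
      convert! this using 1
      simp
    have hs := (hp.sqrt (by simpa using hpos.ne')).const_mul c
    have hl := ((hasDerivAt_id (0 : ℝ)).mul_const F).const_add (c * √(v ⬝ᵥ v))
    convert! hs.sub hl using 1
    simp
  have hmin : IsLocalMin (fun t : ℝ => c * √(v ⬝ᵥ v + 2 * (v ⬝ᵥ w) * t + (w ⬝ᵥ w) * t ^ 2) -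
      (c * √(v ⬝ᵥ v) + t * F)) 0 :=
    Filter.Eventually.of_forall fun t => by simpa using key t
  have := hmin.hasDerivAt_eq_zero hd
  have hne : √(v ⬝ᵥ v) ≠ 0 := (Real.sqrt_pos.2 hpos).ne'
  rw [← sub_eq_zero.1 this]
  field_simp

end GaussianIntegrals

section QuadraticForm

/-! ### The quadratic form of a positive semidefinite matrix -/

theorem opNorm_nonneg {n : ℕ} (A : Matrix (Fin n) (Fin n) ℝ) : 0 ≤ opNorm A := norm_nonneg _

theorem eq_zero_of_opNorm_eq_zero {n : ℕ} {A : Matrix (Fin n) (Fin n) ℝ} (h : opNorm A = 0) :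
    A = 0 := by
  unfold opNorm at h
  rw [norm_eq_zero] at h
  exact Matrix.toEuclideanCLM.injective (h.trans (map_zero _).symm)

theorem dotProduct_mulVec_le_opNorm {n : ℕ} (A : Matrix (Fin n) (Fin n) ℝ) (u : Fin n → ℝ) :
    u ⬝ᵥ A.mulVec u ≤ opNorm A * (u ⬝ᵥ u) := by
  have h := Matrix.inner_toEuclideanCLM A (WithLp.toLp 2 u) (WithLp.toLp 2 u)
  have hu : ‖WithLp.toLp 2 u‖ * ‖WithLp.toLp 2 u‖ = u ⬝ᵥ u := by
    rw [← sq, EuclideanSpace.norm_sq_eq]; simp [dotProduct, sq]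
  simp only at h
  rw [← h, ← hu]
  refine (real_inner_le_norm _ _).trans ?_
  have := (Matrix.toEuclideanCLM (𝕜 := ℝ) A).le_opNorm (WithLp.toLp 2 u)
  calc _ ≤ ‖WithLp.toLp 2 u‖ * (opNorm A * ‖WithLp.toLp 2 u‖) :=
        mul_le_mul_of_nonneg_left this (norm_nonneg _)
    _ = _ := by ring

variable {n : ℕ} {A : Matrix (Fin n) (Fin n) ℝ}

theorem Matrix.PosSemidef.real_dotProduct_mulVec_nonneg (hA : A.PosSemidef) (u : Fin n → ℝ) :
    0 ≤ u ⬝ᵥ A.mulVec u := by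
  simpa using hA.dotProduct_mulVec_nonneg u

theorem Matrix.PosSemidef.dotProduct_mulVec_comm (hA : A.PosSemidef) (u w : Fin n → ℝ) :
    u ⬝ᵥ A.mulVec w = w ⬝ᵥ A.mulVec u := by
  have h : A.transpose = A := by simpa using hA.isHermitian.eq
  rw [Matrix.dotProduct_mulVec, ← Matrix.mulVec_transpose, h, dotProduct_comm]

theorem dotProduct_mulVec_eq_sum (A : Matrix (Fin n) (Fin n) ℝ) (u w : Fin n → ℝ) :
    u ⬝ᵥ A.mulVec w = ∑ i, ∑ j, A i j * (u i * w j) := by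
  simp only [dotProduct, Matrix.mulVec, Finset.mul_sum]
  exact Finset.sum_congr rfl fun i _ => Finset.sum_congr rfl fun j _ => by ring

/-- Splitting the Gram matrix by coordinates reduces inequalities for vector families to ones for
the scalar form `u ⬝ᵥ A.mulVec u`. -/
theorem sum_mul_dotProduct (A : Matrix (Fin n) (Fin n) ℝ) (P R : Fin n → Fin n → ℝ) :
    ∑ i, ∑ j, A i j * (P i ⬝ᵥ R j) = ∑ k, (fun i => P i k) ⬝ᵥ A.mulVec (fun i => R i k) := by
  simp only [dotProduct_mulVec_eq_sum]
  simp only [dotProduct, Finset.mul_sum]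
  symm
  rw [Finset.sum_comm]
  exact Finset.sum_congr rfl fun i _ => Finset.sum_comm

theorem sum_mul_dotProduct_le (A : Matrix (Fin n) (Fin n) ℝ) (P : Fin n → Fin n → ℝ) :
    ∑ i, ∑ j, A i j * (P i ⬝ᵥ P j) ≤ opNorm A * ∑ i, P i ⬝ᵥ P i := by
  rw [sum_mul_dotProduct, Finset.mul_sum]
  refine (Finset.sum_le_sum fun k _ => dotProduct_mulVec_le_opNorm A _).trans_eq ?_
  simp only [dotProduct, Finset.mul_sum]
  exact Finset.sum_comm

/-- A weighted form of the triangle inequality for the seminorm defined by `A`. -/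
theorem Matrix.PosSemidef.sum_mul_dotProduct_ge (hA : A.PosSemidef) {t : ℝ} (ht : 0 ≤ t)
    (P R : Fin n → Fin n → ℝ) :
    t * (1 - t) * ∑ i, ∑ j, A i j * (P i ⬝ᵥ P j) -
        ∑ i, ∑ j, A i j * ((P i - R i) ⬝ᵥ (P j - R j)) ≤
      t * ∑ i, ∑ j, A i j * (R i ⬝ᵥ R j) := by
  rw [sum_mul_dotProduct, sum_mul_dotProduct A (fun i => P i - R i) (fun i => P i - R i),
    sum_mul_dotProduct, Finset.mul_sum, Finset.mul_sum, ← Finset.sum_sub_distrib]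
  refine Finset.sum_le_sum fun k _ => ?_
  set a : Fin n → ℝ := fun i => P i k
  set b : Fin n → ℝ := fun i => R i k
  have hab : (fun i => (P i - R i) k) = a - b := rfl
  -- With `d = a - b`, nonnegativity of the form at `t a - d` controls the cross term in the
  -- expansion of `b = a - d`.
  have h1 := hA.real_dotProduct_mulVec_nonneg (t • a - (a - b))
  have h2 := mul_nonneg ht (hA.real_dotProduct_mulVec_nonneg (a - b))
  rw [hab]
  simp only [Matrix.mulVec_sub, Matrix.mulVec_smul, dotProduct_sub, sub_dotProduct,
    dotProduct_smul, smul_dotProduct, smul_eq_mul, hA.dotProduct_mulVec_comm b a] at h1 h2 ⊢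
  linarith

/-- Normalizing vectors whose squared lengths are close to `1 / n`. -/
theorem normalize_dist_sq_le {m : ℝ} (hm : 0 < m) (v : Fin n → ℝ) :
    (√m • v - (√(v ⬝ᵥ v))⁻¹ • v) ⬝ᵥ (√m • v - (√(v ⬝ᵥ v))⁻¹ • v) ≤ m * |v ⬝ᵥ v - 1 / m| := by
  have hv : 0 ≤ v ⬝ᵥ v := by simpa using dotProduct_star_self_nonneg v
  rw [← sub_smul, smul_dotProduct, dotProduct_smul, smul_eq_mul, smul_eq_mul]
  obtain ⟨r, hr, hrv⟩ : ∃ r, 0 ≤ r ∧ v ⬝ᵥ v = r ^ 2 := ⟨_, Real.sqrt_nonneg _, (Real.sq_sqrt hv).symm⟩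
  obtain ⟨k, hk, hkm⟩ : ∃ k, 0 < k ∧ m = k ^ 2 := ⟨_, Real.sqrt_pos.2 hm, (Real.sq_sqrt hm.le).symm⟩
  rw [hrv, hkm, Real.sqrt_sq hr, Real.sqrt_sq hk.le]
  rcases hr.eq_or_lt with h0 | hpos
  · rw [← h0]; simp; positivity
  have e1 : (k - r⁻¹) * ((k - r⁻¹) * r ^ 2) = |k * r - 1| * |k * r - 1| := by
    rw [abs_mul_abs_self]; field_simp
  have e2 : k ^ 2 * |r ^ 2 - 1 / k ^ 2| = |k * r - 1| * |k * r + 1| := by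
    rw [← abs_mul, ← abs_of_pos (pow_pos hk 2), ← abs_mul, abs_of_pos (pow_pos hk 2)]
    congr 1; field_simp; ring
  rw [e1, e2]
  -- Only `|k r - 1| ≤ k r + 1` is left.
  refine mul_le_mul_of_nonneg_left ?_ (abs_nonneg _)
  have : 0 < k * r := mul_pos hk hpos
  rw [abs_of_pos (by linarith : 0 < k * r + 1), abs_le]
  constructor <;> linarith

/-- Replacing vectors of squared length about `1 / n` by unit vectors changes the value of the
quadratic form by little. -/
theorem Matrix.PosSemidef.le_sum_mul_normalize (hA : A.PosSemidef) {ε : ℝ} (hε : 0 < ε)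
    (hn : 0 < n) {v : Fin n → Fin n → ℝ} (hv : ∑ i, v i ⬝ᵥ v i = 1)
    (hd : ∑ i, |v i ⬝ᵥ v i - 1 / (n : ℝ)| ≤ ε ^ 4) :
    n * (∑ i, ∑ j, A i j * (v i ⬝ᵥ v j)) - 2 * ε ^ 2 * (n * opNorm A) ≤
      ∑ i, ∑ j, A i j * (((√(v i ⬝ᵥ v i))⁻¹ • v i) ⬝ᵥ ((√(v j ⬝ᵥ v j))⁻¹ • v j)) := by
  have hn' : (0 : ℝ) < n := by exact_mod_cast hn
  have hK := opNorm_nonneg A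
  -- The weight `t = ε²` balances the two errors: after division by `t`, both the relative loss `t`
  -- and the distance term `ε⁴ / t` are `ε²`.
  have h1 := hA.sum_mul_dotProduct_ge (sq_nonneg ε) (fun i => √(n : ℝ) • v i)
    (fun i => (√(v i ⬝ᵥ v i))⁻¹ • v i)
  have h2 := sum_mul_dotProduct_le A (fun i => √(n : ℝ) • v i - (√(v i ⬝ᵥ v i))⁻¹ • v i)
  have h3 : ∑ i, (√(n : ℝ) • v i - (√(v i ⬝ᵥ v i))⁻¹ • v i) ⬝ᵥ
      (√(n : ℝ) • v i - (√(v i ⬝ᵥ v i))⁻¹ • v i) ≤ n * ε ^ 4 := by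
    refine (Finset.sum_le_sum fun i _ => normalize_dist_sq_le hn' (v i)).trans ?_
    rw [← Finset.mul_sum]
    exact mul_le_mul_of_nonneg_left hd hn'.le
  have h4 : ∑ i, ∑ j, A i j * ((√(n : ℝ) • v i) ⬝ᵥ (√(n : ℝ) • v j)) =
      n * ∑ i, ∑ j, A i j * (v i ⬝ᵥ v j) := by
    simp only [Finset.mul_sum, smul_dotProduct, dotProduct_smul, smul_eq_mul]
    refine Finset.sum_congr rfl fun i _ => Finset.sum_congr rfl fun j _ => ?_
    rw [← mul_assoc √(n : ℝ), Real.mul_self_sqrt hn'.le]; ring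
  have h5 := sum_mul_dotProduct_le A v
  rw [hv, mul_one] at h5
  rw [h4] at h1
  have h6 := h2.trans (mul_le_mul_of_nonneg_left h3 hK)
  have h7 := mul_le_mul_of_nonneg_left h5 (by positivity : 0 ≤ ε ^ 4 * n)
  refine le_of_mul_le_mul_left ?_ (by positivity : 0 < ε ^ 2)
  linarith

end QuadraticForm

/-! ### Second moments of bounded random vectors -/

section Moments

variable {Ω : Type*} [MeasurableSpace Ω] {μ : Measure Ω} {n : ℕ}
  {A ρ : Matrix (Fin n) (Fin n) ℝ}

theorem sum_mul_integral_eq (A : Matrix (Fin n) (Fin n) ℝ) {x : Ω → Fin n → ℝ}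
    (hx : ∀ i j, Integrable (fun ω => x ω i * x ω j) μ) :
    ∑ i, ∑ j, A i j * ∫ ω, x ω i * x ω j ∂μ = ∫ ω, x ω ⬝ᵥ A.mulVec (x ω) ∂μ := by
  simp only [dotProduct_mulVec_eq_sum]
  rw [integral_finsetSum _ fun i _ => integrable_finsetSum _ fun j _ => (hx i j).const_mul (A i j)]
  refine Finset.sum_congr rfl fun i _ => ?_
  rw [integral_finsetSum _ fun j _ => (hx i j).const_mul (A i j)]
  exact Finset.sum_congr rfl fun j _ => (integral_const_mul _ _).symm

theorem Matrix.PosSemidef.sum_mul_integral_nonneg (hA : A.PosSemidef) {x : Ω → Fin n → ℝ}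
    (hx : ∀ i j, Integrable (fun ω => x ω i * x ω j) μ) :
    0 ≤ ∑ i, ∑ j, A i j * ∫ ω, x ω i * x ω j ∂μ := by
  rw [sum_mul_integral_eq A hx]
  exact integral_nonneg fun ω => hA.real_dotProduct_mulVec_nonneg _

theorem sq_le_one_of_abs_le_one {x : ℝ} (h : |x| ≤ 1) : x * x ≤ 1 := by
  rw [← abs_mul_abs_self]; exact mul_le_one₀ h (abs_nonneg _) h

theorem sum_mul_integral_le [IsProbabilityMeasure μ] (A : Matrix (Fin n) (Fin n) ℝ)
    {x : Ω → Fin n → ℝ} (hx : ∀ i j, Integrable (fun ω => x ω i * x ω j) μ)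
    (hb : ∀ ω i, |x ω i| ≤ 1) :
    ∑ i, ∑ j, A i j * ∫ ω, x ω i * x ω j ∂μ ≤ n * opNorm A := by
  rw [sum_mul_integral_eq A hx]
  have hi : Integrable (fun ω => x ω ⬝ᵥ A.mulVec (x ω)) μ := by
    simp only [dotProduct_mulVec_eq_sum]
    exact integrable_finsetSum _ fun i _ => integrable_finsetSum _ fun j _ => (hx i j).const_mul _
  refine (integral_mono hi (integrable_const (n * opNorm A)) fun ω => ?_).trans_eq (by simp)
  refine (dotProduct_mulVec_le_opNorm A _).trans ?_
  rw [mul_comm]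
  refine mul_le_mul_of_nonneg_right ?_ (opNorm_nonneg A)
  exact (Finset.sum_le_sum fun i _ => sq_le_one_of_abs_le_one (hb ω i)).trans_eq (by simp)

theorem objective_eq (A X : Matrix (Fin n) (Fin n) ℝ) :
    objective A X = (opNorm A)⁻¹ * (A * X).trace := by
  simp [objective]

theorem IsApproxSolution.trace_mul_le {δ : ℝ} (h : IsApproxSolution A δ ρ)
    {X : Matrix (Fin n) (Fin n) ℝ} (hX : IsFeasible X) :
    (A * X).trace ≤ (ρ * A).trace + δ * opNorm A := by
  rcases (opNorm_nonneg A).eq_or_lt with h0 | hpos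
  · rw [eq_zero_of_opNorm_eq_zero h0.symm] at *
    simp [← h0]
  have h1 := mul_le_mul_of_nonneg_left (h.2 X hX) hpos.le
  rw [objective_eq, objective_eq, mul_add, mul_inv_cancel_left₀ hpos.ne',
    mul_inv_cancel_left₀ hpos.ne', Matrix.trace_mul_comm A ρ] at h1
  linarith

/-- The second moment matrix of a random vector in `[-1, 1]ⁿ`, with its diagonal raised to `1`
and then scaled to unit trace, is feasible. -/
theorem isFeasible_secondMoment [IsProbabilityMeasure μ] (hn : 0 < n) {x : Ω → Fin n → ℝ}
    (hx : ∀ i j, Integrable (fun ω => x ω i * x ω j) μ) (hb : ∀ ω i, |x ω i| ≤ 1) :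
    IsFeasible ((n : ℝ)⁻¹ • (Matrix.of (fun i j => ∫ ω, x ω i * x ω j ∂μ) +
      Matrix.diagonal fun i => 1 - ∫ ω, x ω i * x ω i ∂μ)) := by
  have hn' : (n : ℝ) ≠ 0 := by exact_mod_cast hn.ne'
  refine ⟨⟨Matrix.PosSemidef.smul (Matrix.PosSemidef.add ?_ (Matrix.PosSemidef.diagonal ?_))
    (by positivity), ?_⟩, fun i => ?_⟩
  · refine Matrix.PosSemidef.of_dotProduct_mulVec_nonneg ?_ fun u => ?_
    · ext i j; simp [mul_comm]
    · rw [star_trivial, dotProduct_mulVec_eq_sum]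
      have h := sum_mul_integral_eq (Matrix.of fun i j => u i * u j) hx
      have hE : ∀ ω, x ω ⬝ᵥ (Matrix.of fun i j => u i * u j).mulVec (x ω) = (u ⬝ᵥ x ω) ^ 2 :=
        fun ω => by
        rw [dotProduct_mulVec_eq_sum]
        simp only [dotProduct, sq, Finset.sum_mul_sum, Matrix.of_apply]
        exact Finset.sum_congr rfl fun i _ => Finset.sum_congr rfl fun j _ => by ring
      simp only [hE] at h
      have h2 : 0 ≤ ∫ ω, (u ⬝ᵥ x ω) ^ 2 ∂μ := integral_nonneg fun ω => sq_nonneg _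
      rw [← h] at h2
      refine h2.trans_eq (Finset.sum_congr rfl fun i _ => Finset.sum_congr rfl fun j _ => ?_)
      simp only [Matrix.of_apply]; ring
  · intro i
    have : ∫ ω, x ω i * x ω i ∂μ ≤ ∫ _, 1 ∂μ :=
      integral_mono (hx i i) (integrable_const _) fun ω => sq_le_one_of_abs_le_one (hb ω i)
    simpa using this
  · simp [Matrix.trace, ← mul_add, hn']
  · simp

/-- Raising the diagonal to `1` can only increase the value, since a psd `A` has nonnegative
diagonal; the corrected matrix is then tested against `ρ`. -/
theorem sum_mul_integral_le_of_isApproxSolution [IsProbabilityMeasure μ] (hA : A.PosSemidef)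
    {δ : ℝ} (h : IsApproxSolution A δ ρ) (hn : 0 < n) {x : Ω → Fin n → ℝ}
    (hx : ∀ i j, Integrable (fun ω => x ω i * x ω j) μ) (hb : ∀ ω i, |x ω i| ≤ 1) :
    ∑ i, ∑ j, A i j * ∫ ω, x ω i * x ω j ∂μ ≤ n * ((ρ * A).trace + δ * opNorm A) := by
  have hn' : (0 : ℝ) < n := by exact_mod_cast hn
  refine le_trans ?_
    (mul_le_mul_of_nonneg_left (h.trace_mul_le (isFeasible_secondMoment hn hx hb)) hn'.le)
  rw [Matrix.mul_smul, Matrix.trace_smul, smul_eq_mul, mul_inv_cancel_left₀ hn'.ne',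
    Matrix.mul_add, Matrix.trace_add]
  have h1 : (A * Matrix.of fun i j => ∫ ω, x ω i * x ω j ∂μ).trace =
      ∑ i, ∑ j, A i j * ∫ ω, x ω i * x ω j ∂μ := by
    simp [Matrix.trace, Matrix.mul_apply, mul_comm]
  have h2 : 0 ≤ (A * Matrix.diagonal fun i => 1 - ∫ ω, x ω i * x ω i ∂μ).trace := by
    simp only [Matrix.trace, Matrix.diag_apply, Matrix.mul_diagonal]
    refine Finset.sum_nonneg fun i _ => mul_nonneg hA.diag_nonneg ?_
    have : ∫ ω, x ω i * x ω i ∂μ ≤ ∫ _, 1 ∂μ :=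
      integral_mono (hx i i) (integrable_const _) fun ω => sq_le_one_of_abs_le_one (hb ω i)
    simpa using this
  linarith

end Moments

/-! ### Gaussian rounding -/

section Rounding

variable {n : ℕ} {A : Matrix (Fin n) (Fin n) ℝ} {s : ℝ}

theorem integrable_signWith_mul_signWith (hs : |s| ≤ 1) (v w : Fin n → ℝ) :
    Integrable (fun g => signWith s (v ⬝ᵥ g) * signWith s (w ⬝ᵥ g)) (stdGaussianVec n) := by
  refine Integrable.of_bound (C := 1) (((measurable_signWith s).comp
    (measurable_dotProduct_right v)).mul ((measurable_signWith s).comp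
    (measurable_dotProduct_right w))).aestronglyMeasurable
    (Filter.Eventually.of_forall fun g => ?_)
  rw [norm_mul]
  exact mul_le_one₀ (abs_signWith_le hs) (norm_nonneg _) (abs_signWith_le hs)

/-- Subtracting from the signs of `⟨v i, g⟩` their linear parts shows that the second moment
matrix of the signs dominates `2 / π` times the Gram matrix of the normalized vectors. -/
theorem Matrix.PosSemidef.sum_mul_normalize_le_integral_signWith (hA : A.PosSemidef)
    (hs : |s| ≤ 1) (v : Fin n → Fin n → ℝ) :
    2 / Real.pi *
        ∑ i, ∑ j, A i j * (((√(v i ⬝ᵥ v i))⁻¹ • v i) ⬝ᵥ ((√(v j ⬝ᵥ v j))⁻¹ • v j)) ≤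
      ∑ i, ∑ j, A i j * ∫ g, signWith s (v i ⬝ᵥ g) * signWith s (v j ⬝ᵥ g)
        ∂(stdGaussianVec n) := by
  set w : Fin n → Fin n → ℝ := fun i => (√(v i ⬝ᵥ v i))⁻¹ • v i with hw
  set c := √(2 / Real.pi) with hc
  have hcc : c * c = 2 / Real.pi := Real.mul_self_sqrt (by positivity)
  have hxx := fun i j => integrable_signWith_mul_signWith hs (v i) (v j)
  have hxy := fun i j => (integrable_signWith_mul hs (v i) (w j)).const_mul c
  have hyy := fun i j =>
    ((memLp_dotProduct (w i)).integrable_mul (memLp_dotProduct (w j))).const_mul (c * c)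
  have hexp : ∀ i j, (fun g => (signWith s (v i ⬝ᵥ g) - c * (w i ⬝ᵥ g)) *
      (signWith s (v j ⬝ᵥ g) - c * (w j ⬝ᵥ g))) =
      fun g => signWith s (v i ⬝ᵥ g) * signWith s (v j ⬝ᵥ g) -
        c * (signWith s (v i ⬝ᵥ g) * (w j ⬝ᵥ g)) - c * (signWith s (v j ⬝ᵥ g) * (w i ⬝ᵥ g)) +
        c * c * ((w i ⬝ᵥ g) * (w j ⬝ᵥ g)) := fun i j => by
    ext g; ring
  have hint : ∀ i j, Integrable (fun g => (signWith s (v i ⬝ᵥ g) - c * (w i ⬝ᵥ g)) *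
      (signWith s (v j ⬝ᵥ g) - c * (w j ⬝ᵥ g))) (stdGaussianVec n) := fun i j => by
    rw [hexp]
    exact (((hxx i j).sub (hxy i j)).sub (hxy j i)).add (hyy i j)
  -- Each cross term contributes `-c² ⟨w i, w j⟩` and the quadratic term `+c² ⟨w i, w j⟩`, so a
  -- single `-2/π` survives.
  have hval : ∀ i j, ∫ g, (signWith s (v i ⬝ᵥ g) - c * (w i ⬝ᵥ g)) *
      (signWith s (v j ⬝ᵥ g) - c * (w j ⬝ᵥ g)) ∂(stdGaussianVec n) =
      ∫ g, signWith s (v i ⬝ᵥ g) * signWith s (v j ⬝ᵥ g) ∂(stdGaussianVec n) -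
        2 / Real.pi * (w i ⬝ᵥ w j) := fun i j => by
    rw [hexp, integral_add (by exact ((hxx i j).sub (hxy i j)).sub (hxy j i)) (by exact hyy i j),
      integral_sub (by exact (hxx i j).sub (hxy i j)) (hxy j i), integral_sub (hxx i j) (hxy i j),
      integral_const_mul, integral_const_mul, integral_const_mul, integral_dotProduct_mul,
      integral_signWith_mul hs, integral_signWith_mul hs, ← hc, ← hcc]
    have e : ∀ i j, (√(v i ⬝ᵥ v i))⁻¹ * (v i ⬝ᵥ w j) = w i ⬝ᵥ w j := fun i j => by
      simp only [hw, smul_dotProduct, smul_eq_mul]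
    rw [e, e, dotProduct_comm (w j) (w i)]
    ring
  have h := hA.sum_mul_integral_nonneg hint
  simp only [hval] at h
  simp only [mul_sub, Finset.sum_sub_distrib] at h
  refine (sub_nonneg.1 h).trans' (le_of_eq ?_)
  simp only [Finset.mul_sum]
  exact Finset.sum_congr rfl fun i _ => Finset.sum_congr rfl fun j _ => by ring

theorem col_sqrt_dotProduct_col_sqrt {ρ : Matrix (Fin n) (Fin n) ℝ} (hρ : ρ.PosSemidef)
    (i j : Fin n) : (CFC.sqrt ρ).col i ⬝ᵥ (CFC.sqrt ρ).col j = ρ i j := by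
  have h1 : CFC.sqrt ρ * CFC.sqrt ρ = ρ := CFC.sqrt_mul_sqrt_self ρ hρ.nonneg
  have h2 : (CFC.sqrt ρ).transpose = CFC.sqrt ρ := by
    have := (Matrix.nonneg_iff_posSemidef.1 (CFC.sqrt_nonneg ρ)).isHermitian.eq
    simpa using this
  have h3 : ∀ k, CFC.sqrt ρ k i = CFC.sqrt ρ i k := fun k => congrFun₂ h2 i k
  conv_rhs => rw [← h1]
  simp [Matrix.mul_apply, dotProduct, h3]

end Rounding

theorem mainTheorem6 :
    ∃ C : ℝ, 0 < C ∧
      ∀ (n : ℕ) (A ρ : Matrix (Fin n) (Fin n) ℝ) (ε s₀ : ℝ),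
        A.PosSemidef → 0 < ε → IsApproxSolution A (ε ^ 4) ρ → |s₀| ≤ 1 →
          (2 / Real.pi) * (n * (ρ * A).trace) - C * (ε * n * opNorm A) ≤
              ∑ i, ∑ j, A i j * ∫ g, gaussianRounding s₀ ρ g i * gaussianRounding s₀ ρ g j
                ∂(stdGaussianVec n) ∧
            ∑ i, ∑ j, A i j * ∫ g, gaussianRounding s₀ ρ g i * gaussianRounding s₀ ρ g j
                ∂(stdGaussianVec n) ≤
              n * (ρ * A).trace + C * (ε * n * opNorm A) := by
  -- The `2` comes from the loss `2 ε²` in the lower bound; the upper bound needs only `1`.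
  refine ⟨2, two_pos, fun n A ρ ε s₀ hA hε h hs => ?_⟩
  obtain ⟨⟨⟨hρ, htr⟩, hd⟩, -⟩ := id h
  have hn : 0 < n := by
    rcases Nat.eq_zero_or_pos n with rfl | hn
    · simp [Matrix.trace] at htr
    · exact hn
  have hK : 0 ≤ n * opNorm A := mul_nonneg n.cast_nonneg (opNorm_nonneg A)
  set v : Fin n → Fin n → ℝ := fun i => (CFC.sqrt ρ).col i
  have hG : ∀ i j, v i ⬝ᵥ v j = ρ i j := col_sqrt_dotProduct_col_sqrt hρ
  have hT : (ρ * A).trace = ∑ i, ∑ j, A i j * (v i ⬝ᵥ v j) := by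
    have hsymm : ∀ i j, ρ j i = ρ i j := fun i j => by simpa using hρ.isHermitian.apply i j
    rw [Matrix.trace_mul_comm]
    simp only [Matrix.trace, Matrix.diag_apply, Matrix.mul_apply, hG, hsymm]
  have hv : ∑ i, v i ⬝ᵥ v i = 1 := by simp only [hG]; exact htr
  have hx := fun i j => integrable_signWith_mul_signWith hs (v i) (v j)
  have hb : ∀ (g : Fin n → ℝ) i, |gaussianRounding s₀ ρ g i| ≤ 1 := fun g i => abs_signWith_le hs
  have hT0 : 0 ≤ (ρ * A).trace := by
    rw [hT, sum_mul_dotProduct]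
    exact Finset.sum_nonneg fun k _ => hA.real_dotProduct_mulVec_nonneg _
  have hT1 : n * (ρ * A).trace ≤ n * opNorm A := by
    have := sum_mul_dotProduct_le A v
    rw [← hT, hv, mul_one] at this
    exact mul_le_mul_of_nonneg_left this n.cast_nonneg
  have hnT := mul_nonneg n.cast_nonneg hT0
  have hpi : 2 / Real.pi ≤ 1 := (div_le_one Real.pi_pos).2 Real.two_le_pi
  have hpi0 : 0 ≤ 2 / Real.pi := by positivity
  rcases le_total 1 ε with h1 | h1
  -- For `ε ≥ 1` the error term absorbs everything, as the rounded value and `n * (ρ * A).trace`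
  -- both lie in `[0, n * opNorm A]`.
  · have hle : n * opNorm A ≤ ε * (n * opNorm A) := le_mul_of_one_le_left hK h1
    constructor
    · refine le_trans ?_ (hA.sum_mul_integral_nonneg (x := gaussianRounding s₀ ρ) hx)
      have := mul_le_of_le_one_left hnT hpi
      linarith
    · refine (sum_mul_integral_le A (x := gaussianRounding s₀ ρ) hx hb).trans ?_
      linarith
  · constructor
    · refine le_trans ?_ (hA.sum_mul_normalize_le_integral_signWith hs v)
      have h2 := hA.le_sum_mul_normalize hε hn hv (by simpa only [hG] using hd)
      rw [← hT] at h2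
      refine le_trans ?_ (mul_le_mul_of_nonneg_left h2 hpi0)
      have h3 : ε ^ 2 * (n * opNorm A) ≤ ε * (n * opNorm A) :=
        mul_le_mul_of_nonneg_right (pow_le_of_le_one hε.le h1 two_ne_zero) hK
      have h4 := mul_le_of_le_one_left (by positivity : 0 ≤ ε ^ 2 * (n * opNorm A)) hpi
      linarith
    · refine (sum_mul_integral_le_of_isApproxSolution hA h hn
        (x := gaussianRounding s₀ ρ) hx hb).trans ?_
      have h3 : ε ^ 4 * (n * opNorm A) ≤ ε * (n * opNorm A) :=
        mul_le_mul_of_nonneg_right (pow_le_of_le_one hε.le h1 four_ne_zero) hK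
      have := mul_nonneg hε.le hK
      linarith
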